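/- Let $K$ be a field in which every quadratic equation $x^2+ax+b=0$ with $a,b\in K$ has a root (we call such a field quadratically closed), let $G$ be an arbitrary group, and let $f\colon G\to K$ be a function. Call a $K$-valued function on a group $H$ an $SL(2,K)$ character if it has the form $h\mapsto \operatorname{tr}\rho(h)$ for some group homomorphism $\rho\colon H\to SL(2,K)$. Then: 1. $f$ is an $SL(2,K)$ character if and only if its restriction to every subgroup of $G$ generated by two (possibly equal) elements is an $SL(2,K)$ character of that subgroup. 2. $f$ is an $SL(2,K)$ character if and only if it is a $K$-trace function in the sense of Helling, that is, $f(xy)+f(x^{-1}y)=f(x)f(y)$ for all $x,y\in G$, and $f(\mathrm{id})=2$, where $\mathrm{id}$ is the identity element of $G$. -/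

import Mathlib

/-- A field `K` is quadratically closed when each monic quadratic equation
`x ^ 2 + a * x + b = 0` with coefficients in `K` has a root in `K`. -/
def IsQuadClosed (K : Type*) [Field K] : Prop :=
  ∀ a b : K, ∃ x : K, x ^ 2 + a * x + b = 0

/-- `f` is the character `g ↦ tr (ρ g)` of some representation `ρ` of `G` to `SL(2, K)`. -/
def IsSL2Character {K G : Type*} [Field K] [Group G] (f : G → K) : Prop :=
  ∃ ρ : G →* Matrix.SpecialLinearGroup (Fin 2) K,
    ∀ g : G, f g = Matrix.trace (ρ g : Matrix (Fin 2) (Fin 2) K)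

/-- Helling's `K`-trace functions on a group. -/
structure IsTraceFunction {K G : Type*} [Field K] [Group G] (f : G → K) : Prop where
  mul_add : ∀ x y : G, f (x * y) + f (x⁻¹ * y) = f x * f y
  one : f 1 = 2

/-- A 2-generator subgroup: one generated by two (possibly equal or trivial) elements. -/
def IsTwoGenerator {G : Type*} [Group G] (H : Subgroup G) : Prop :=
  ∃ x y : G, H = Subgroup.closure {x, y}

/-! Helling's identity makes the group algebra, modulo the radical of the pairing (a, b) ↦ f(ab), an
algebra whose trace is nondegenerate and satisfies the polarized Cayley-Hamilton identity
(`IsTraceFunction.isReducedTrace`). Quadratic closedness gives each g a root c of x² - f(g)x + 1. If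
some n = g - c is nonzero in the quotient, then n² = T(n)n, which yields an idempotent of trace one,
and its Peirce decomposition gives a representation by 2×2 matrices
(`IsReducedTrace.exists_matrix_rep`). Otherwise every g acts as a scalar and the character is
explicit. The two-generator criterion follows because Helling's identity involves only two elements
at a time. -/

/-! ### Algebras with a reduced trace of degree two -/

section QuadraticAlgebra

variable {K R : Type*} [Field K] [Ring R] [Algebra K R] {T : R →ₗ[K] K}

/-- A linear form `T` that behaves like the reduced trace of an algebra of degree two: it is
symmetric, nondegenerate, has value two at the unit, and satisfies the polarized
Cayley-Hamilton identity. -/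
structure IsReducedTrace (T : R →ₗ[K] K) : Prop where
  comm : ∀ a b, T (a * b) = T (b * a)
  one : T 1 = 2
  eq_zero : ∀ a, (∀ b, T (a * b) = 0) → a = 0
  cayley : ∀ a b, a * b + b * a = T a • b + T b • a + (T (a * b) - T a * T b) • (1 : R)

namespace IsReducedTrace

theorem exists_eq_one (hT : IsReducedTrace T) {n : R} (hn : n ≠ 0) : ∃ b, T (n * b) = 1 := by
  have : ¬ ∀ b, T (n * b) = 0 := fun h => hn (hT.eq_zero n h)
  push Not at this
  obtain ⟨b, hb⟩ := this
  exact ⟨(T (n * b))⁻¹ • b, by simp [hb]⟩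

/-- Multiply the Cayley-Hamilton identity by n on the left: the terms in n * b cancel. -/
theorem mul_mul_self (hT : IsReducedTrace T) {n : R} (hn : n * n = T n • n) (b : R) :
    n * b * n = T (n * b) • n := by
  have h := congrArg (n * ·) (hT.cayley n b)
  simp only [mul_add, mul_smul_comm, ← mul_assoc, hn, mul_one, smul_mul_assoc] at h
  have h2 : n * b * n = T b • T n • n + (T (n * b) - T n * T b) • n := by
    rw [add_assoc] at h
    exact add_left_cancel h
  rw [h2, smul_smul, ← add_smul]
  congr 1
  ring

theorem exists_idempotent (hT : IsReducedTrace T) {n : R} (hn0 : n ≠ 0) (hn : n * n = T n • n) :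
    ∃ e : R, e * e = e ∧ T e = 1 := by
  obtain ⟨b, hb⟩ := hT.exists_eq_one hn0
  refine ⟨n * b, ?_, hb⟩
  rw [← mul_assoc, hT.mul_mul_self hn, hb, one_smul]

theorem corner (hT : IsReducedTrace T) {e : R} (he : e * e = e) (h1 : T e = 1) (a : R) :
    e * a * e = T (e * a) • e :=
  hT.mul_mul_self (by rw [he, h1, one_smul]) a

/-- The off-diagonal Peirce components of an idempotent of trace one are spanned by a pair of
matrix units, unless they vanish. -/
theorem exists_matrix_units (hT : IsReducedTrace T) {e d : R} (hed : e + d = 1)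
    (he : e * e = e) (h1 : T e = 1) :
    ∃ m p : R, m * e = m ∧ d * m = m ∧ e * p = p ∧ p * d = p ∧
      (m * p = d ∧ p * m = e ∨ m = 0 ∧ p = 0) ∧
      (∀ a, e * a * d = T (a * m) • p) ∧ (∀ a, d * a * e = T (a * p) • m) := by
  obtain rfl : d = 1 - e := eq_sub_of_add_eq' hed
  set d := 1 - e with hd
  have hde : d * e = 0 := by rw [hd, sub_mul, he, one_mul, sub_self]
  have hed0 : e * d = 0 := by rw [hd, mul_sub, he, mul_one, sub_self]
  have hdd : d * d = d := by
    conv_lhs => rw [hd, sub_mul, hed0, one_mul, sub_zero]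
  have hd1 : T d = 1 := by rw [hd, map_sub, hT.one, h1]; norm_num
  by_cases hM : ∀ a, d * a * e = 0
  -- Nondegeneracy and symmetry pair the two off-diagonal components, so they vanish together.
  · have hP : ∀ a, e * a * d = 0 := fun a => hT.eq_zero _ fun b => by
      rw [mul_assoc, mul_assoc, hT.comm, mul_assoc, hM, mul_zero, map_zero]
    exact ⟨0, 0, by simp, by simp, by simp, by simp, Or.inr ⟨rfl, rfl⟩,
      by simpa using hP, by simpa using hM⟩
  · push Not at hM
    obtain ⟨c, hc⟩ := hM
    set m := d * c * e with hm
    have hme : m * e = m := by rw [hm, mul_assoc, he]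
    have hdm : d * m = m := by rw [hm, ← mul_assoc, ← mul_assoc, hdd]
    obtain ⟨b, hb⟩ := hT.exists_eq_one hc
    set p := e * b * d with hp
    have hep : e * p = p := by rw [hp, ← mul_assoc, ← mul_assoc, he]
    have hpd : p * d = p := by rw [hp, mul_assoc, hdd]
    have hmp : m * p = d := by
      have : m * p = d * (m * b) * d := by
        rw [hp, ← mul_assoc, ← mul_assoc, hme, ← mul_assoc, hdm]
      rw [this, hT.corner hdd hd1, ← mul_assoc, hdm, hb, one_smul]
    have hpm : p * m = e := by
      have : p * m = e * (b * m) * e := by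
        rw [hp, mul_assoc, hdm, mul_assoc, mul_assoc, mul_assoc, hme]
      rw [this, hT.corner he h1, hT.comm, mul_assoc, hme, hT.comm, hb, one_smul]
    have hem : e * m = 0 := by rw [← hdm, ← mul_assoc, hed0, zero_mul]
    have hdp : d * p = 0 := by rw [← hep, ← mul_assoc, hde, zero_mul]
    have hTm : T m = 0 := by rw [← hme, hT.comm, hem, map_zero]
    have hTp : T p = 0 := by rw [← hpd, hT.comm, hdp, map_zero]
    -- Since m and p square to zero, `mul_mul_self` applies to both and shows that each spans its
    -- component.
    have hmm : m * m = T m • m := by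
      rw [hTm, zero_smul]; nth_rw 1 [← hme]; rw [mul_assoc, hem, mul_zero]
    have hpp : p * p = T p • p := by
      rw [hTp, zero_smul]; nth_rw 1 [← hpd]; rw [mul_assoc, hdp, mul_zero]
    refine ⟨m, p, hme, hdm, hep, hpd, Or.inl ⟨hmp, hpm⟩, fun a => ?_, fun a => ?_⟩
    · calc e * a * d = p * (m * a * m) * p := by simp only [← hmp, ← hpm, mul_assoc]
        _ = T (a * m) • p := by
          rw [hT.mul_mul_self hmm, hT.comm m, mul_smul_comm, hpm, smul_mul_assoc, hep]
    · calc d * a * e = m * (p * a * p) * m := by simp only [← hmp, ← hpm, mul_assoc]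
        _ = T (a * p) • m := by
          rw [hT.mul_mul_self hpp, hT.comm p, mul_smul_comm, hmp, smul_mul_assoc, hdm]

theorem exists_matrix_rep (hT : IsReducedTrace T) {n : R} (hn0 : n ≠ 0) (hn : n * n = T n • n) :
    ∃ φ : R →ₐ[K] Matrix (Fin 2) (Fin 2) K, ∀ a, (φ a).trace = T a := by
  obtain ⟨e, he, h1⟩ := hT.exists_idempotent hn0 hn
  obtain ⟨d, hed⟩ : ∃ d, e + d = 1 := ⟨1 - e, add_sub_cancel _ _⟩
  have hd : d = 1 - e := eq_sub_of_add_eq' hed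
  have hde : d * e = 0 := by rw [hd, sub_mul, he, one_mul, sub_self]
  have hdd : d * d = d := by
    nth_rw 2 [hd]
    rw [mul_sub, hde, mul_one, sub_zero]
  have hed0 : e * d = 0 := by rw [hd, mul_sub, he, mul_one, sub_self]
  have hd1 : T d = 1 := by
    rw [hd, map_sub, hT.one, h1]; norm_num
  obtain ⟨m, p, hme, hdm, hep, hpd, hmp, hm, hp⟩ := hT.exists_matrix_units hed he h1
  have hTm : T m = 0 := by
    rw [← hme, hT.comm, ← hdm, ← mul_assoc, hed0, zero_mul, map_zero]
  have hTp : T p = 0 := by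
    rw [← hpd, hT.comm, ← hep, ← mul_assoc, hde, zero_mul, map_zero]
  have split : ∀ x a b, T (x * (a * b)) = T (x * a * e * b) + T (x * a * d * b) := fun x a b => by
    rw [← map_add, ← add_mul, ← mul_add, hed, mul_one, mul_assoc]
  -- The entries are the Peirce coordinates of a with respect to e, p, m, d.
  refine ⟨.ofLinearMap
    { toFun := fun a => !![T (e * a), T (m * a); T (p * a), T (d * a)]
      map_add' := fun a b => by simp [mul_add]
      map_smul' := fun c a => by simp } ?_ fun a b => ?_, fun a => ?_⟩
  · simp [h1, hd1, hTm, hTp, Matrix.one_fin_two]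
  · ext i j
    have hm' : ∀ a, m * a * d = T (m * a) • (m * p) := fun a => by
      nth_rw 1 [← hme]
      rw [mul_assoc, mul_assoc, ← mul_assoc e, hm, mul_smul_comm, hT.comm a]
    have hp' : ∀ a, p * a * e = T (p * a) • (p * m) := fun a => by
      nth_rw 1 [← hpd]
      rw [mul_assoc, mul_assoc, ← mul_assoc d, hp, mul_smul_comm, hT.comm a]
    have hm2 : ∀ a, m * a * e = T (e * a) • m := fun a => by
      nth_rw 1 [← hme]
      rw [mul_assoc, mul_assoc, ← mul_assoc e, hT.corner he h1, mul_smul_comm, hme]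
    have hp2 : ∀ a, p * a * d = T (d * a) • p := fun a => by
      nth_rw 1 [← hpd]
      rw [mul_assoc, mul_assoc, ← mul_assoc d, hT.corner hdd hd1, mul_smul_comm, hpd]
    fin_cases i <;> fin_cases j
    · simp [Matrix.mul_apply, split e, hT.corner he h1, hm, hT.comm a]
    · rcases hmp with ⟨h, -⟩ | ⟨rfl, rfl⟩
      · simp [Matrix.mul_apply, split m, hm', hm2, h]
      · simp [Matrix.mul_apply]
    · rcases hmp with ⟨-, h⟩ | ⟨rfl, rfl⟩
      · simp [Matrix.mul_apply, split p, hp', hp2, h]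
      · simp [Matrix.mul_apply]
    · simp [Matrix.mul_apply, split d, hT.corner hdd hd1, hp, hT.comm a]
  · simp [Matrix.trace_fin_two, ← map_add, ← add_mul, hed]

end IsReducedTrace

end QuadraticAlgebra

namespace IsSL2Character

variable {K G : Type*} [Field K] [Group G] {f : G → K}

theorem isTraceFunction (hf : IsSL2Character f) : IsTraceFunction f := by
  obtain ⟨ρ, hρ⟩ := hf
  refine ⟨fun x y => ?_, by simp [hρ]⟩
  simp only [hρ, map_mul, map_inv, Matrix.SpecialLinearGroup.coe_mul,
    Matrix.SpecialLinearGroup.coe_inv, Matrix.adjugate_fin_two, Matrix.trace_fin_two,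
    Matrix.mul_apply, Fin.sum_univ_two, Matrix.of_apply, Matrix.cons_val', Matrix.cons_val_zero,
    Matrix.cons_val_one, Matrix.cons_val_fin_one]
  ring

theorem comp {H : Type*} [Group H] (hf : IsSL2Character f) (i : H →* G) :
    IsSL2Character (fun h => f (i h)) := by
  obtain ⟨ρ, hρ⟩ := hf
  exact ⟨ρ.comp i, fun h => hρ (i h)⟩

/-- Here y is tr x - x, the adjugate of x, so x * y is det x times the identity. -/
theorem _root_.Matrix.det_eq_one_of_mul_eq_one {x y : Matrix (Fin 2) (Fin 2) K} (h : x * y = 1)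
    (hxy : x + y = x.trace • (1 : Matrix (Fin 2) (Fin 2) K)) : x.det = 1 := by
  have hy : y = x.adjugate := by
    rw [eq_sub_of_add_eq' hxy]
    ext i j
    fin_cases i <;> fin_cases j <;> simp [Matrix.adjugate_fin_two, Matrix.trace_fin_two]
  rw [hy, Matrix.mul_adjugate] at h
  simpa using congrFun (congrFun h 0) 0

theorem of_matrix_rep (φ : G →* Matrix (Fin 2) (Fin 2) K) (hφ : ∀ g, (φ g).trace = f g)
    (hdet : ∀ g, (φ g).det = 1) : IsSL2Character f :=
  ⟨⟨⟨fun g => ⟨φ g, hdet g⟩, Subtype.ext (map_one φ)⟩, fun _ _ => Subtype.ext (map_mul φ _ _)⟩,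
    fun g => (hφ g).symm⟩

end IsSL2Character

section LinearForm

variable {K G : Type*} [Field K]

/-- The linear extension of a function on a group to the group algebra. -/
noncomputable def MonoidAlgebra.linearForm (f : G → K) : MonoidAlgebra K G →ₗ[K] K :=
  Finsupp.linearCombination K f ∘ₗ (MonoidAlgebra.coeffLinearEquiv K).toLinearMap

theorem MonoidAlgebra.linearForm_single (f : G → K) (g : G) (c : K) :
    MonoidAlgebra.linearForm f (.single g c) = c * f g := by
  simp [MonoidAlgebra.linearForm]

end LinearForm

/-! ### The reduced group algebra of a trace function -/

namespace IsTraceFunction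

variable {K G : Type*} [Field K] [Group G] {f : G → K}

theorem map_inv (hf : IsTraceFunction f) (x : G) : f x⁻¹ = f x := by
  have := hf.mul_add x 1
  rw [mul_one, mul_one, hf.one] at this
  linear_combination this

theorem map_mul_comm (hf : IsTraceFunction f) (x y : G) : f (x * y) = f (y * x) := by
  have h := hf.map_inv (x⁻¹ * y)
  rw [mul_inv_rev, inv_inv] at h
  linear_combination hf.mul_add x y - hf.mul_add y x + h

theorem linearForm_comm (hf : IsTraceFunction f) (a b : MonoidAlgebra K G) :
    MonoidAlgebra.linearForm f (a * b) = MonoidAlgebra.linearForm f (b * a) := by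
  induction a using MonoidAlgebra.induction_linear with
  | zero => simp
  | add a a' h h' => simp only [add_mul, _root_.mul_add, map_add, h, h']
  | single g c =>
    induction b using MonoidAlgebra.induction_linear with
    | zero => simp
    | add a a' h h' => simp only [add_mul, _root_.mul_add, map_add, h, h']
    | single h d =>
      simp only [MonoidAlgebra.single_mul_single, MonoidAlgebra.linearForm_single, hf.map_mul_comm g h,
        mul_comm c d]

/-- The radical congruence of the trace pairing on the group algebra. -/
noncomputable def radical (hf : IsTraceFunction f) : RingCon (MonoidAlgebra K G) where
  r a b := ∀ x, MonoidAlgebra.linearForm f (a * x) = MonoidAlgebra.linearForm f (b * x)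
  iseqv := ⟨fun _ _ => rfl, fun h x => (h x).symm, fun h h' x => (h x).trans (h' x)⟩
  add' h h' x := by rw [add_mul, add_mul, map_add, map_add, h, h']
  mul' {a b c d} h h' x := by
    rw [mul_assoc, h, hf.linearForm_comm, mul_assoc, h', ← mul_assoc, hf.linearForm_comm,
      ← mul_assoc]

theorem radical_iff (hf : IsTraceFunction f) {a b : MonoidAlgebra K G} :
    (a : hf.radical.Quotient) = b ↔ ∀ x, MonoidAlgebra.linearForm f (a * x) = MonoidAlgebra.linearForm f (b * x) :=
  RingCon.eq _

/-- The linear form induced on the quotient by the radical. -/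
noncomputable def reducedTrace (hf : IsTraceFunction f) : hf.radical.Quotient →ₗ[K] K where
  toFun := Quotient.lift (MonoidAlgebra.linearForm f) fun a b h => by simpa using h 1
  map_add' a b := Quotient.inductionOn₂ a b fun a b => map_add (MonoidAlgebra.linearForm f) a b
  map_smul' c a := Quotient.inductionOn a fun a => map_smul (MonoidAlgebra.linearForm f) c a

theorem reducedTrace_coe (hf : IsTraceFunction f) (a : MonoidAlgebra K G) :
    hf.reducedTrace a = MonoidAlgebra.linearForm f a := rfl

/-- The tautological homomorphism from the group to the reduced group algebra. -/
noncomputable def of (hf : IsTraceFunction f) : G →* hf.radical.Quotient :=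
  (hf.radical.mk' : _ →* hf.radical.Quotient).comp (MonoidAlgebra.of K G)

theorem coe_single (hf : IsTraceFunction f) (g : G) (c : K) :
    ((MonoidAlgebra.single g c : MonoidAlgebra K G) : hf.radical.Quotient) = c • hf.of g := by
  change _ = c • ((MonoidAlgebra.single g 1 : MonoidAlgebra K G) : hf.radical.Quotient)
  rw [← RingCon.coe_smul, MonoidAlgebra.smul_single, smul_eq_mul, mul_one]

theorem reducedTrace_of (hf : IsTraceFunction f) (g : G) : hf.reducedTrace (hf.of g) = f g := by
  change MonoidAlgebra.linearForm f (MonoidAlgebra.single g 1) = f g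
  rw [MonoidAlgebra.linearForm_single, one_mul]

theorem of_add_of_inv (hf : IsTraceFunction f) (g : G) :
    hf.of g + hf.of g⁻¹ = f g • (1 : hf.radical.Quotient) := by
  change ((MonoidAlgebra.single g 1 + MonoidAlgebra.single g⁻¹ 1 : MonoidAlgebra K G) :
    hf.radical.Quotient) = ((f g • 1 : MonoidAlgebra K G) : hf.radical.Quotient)
  rw [radical_iff]
  intro x
  induction x using MonoidAlgebra.induction_linear with
  | zero => simp
  | add a a' h h' => simp only [_root_.mul_add, map_add, h, h']
  | single h d =>
    simp only [add_mul, MonoidAlgebra.single_mul_single, map_add, MonoidAlgebra.linearForm_single,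
      smul_mul_assoc, one_mul, map_smul, smul_eq_mul]
    linear_combination d * hf.mul_add g h

theorem of_mul_add_of_mul (hf : IsTraceFunction f) (g h : G) :
    hf.of g * hf.of h + hf.of h * hf.of g =
      f g • hf.of h + f h • hf.of g + (f (g * h) - f g * f h) • (1 : hf.radical.Quotient) := by
  have key : ∀ x y : G, hf.of x * hf.of y + hf.of (x⁻¹ * y) = f x • hf.of y := fun x y => by
    rw [map_mul, ← add_mul, hf.of_add_of_inv, smul_mul_assoc, one_mul]
  -- The leftover terms g⁻¹h and h⁻¹g are mutually inverse, so their sum is scalar.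
  have hinv := hf.of_add_of_inv (g⁻¹ * h)
  rw [mul_inv_rev, inv_inv, eq_sub_of_add_eq' (hf.mul_add g h)] at hinv
  linear_combination (norm := module) key g h + key h g - hinv

theorem isReducedTrace (hf : IsTraceFunction f) : IsReducedTrace hf.reducedTrace where
  comm a b := Quotient.inductionOn₂ a b fun a b => hf.linearForm_comm a b
  one := by
    rw [← RingCon.coe_one, reducedTrace_coe, MonoidAlgebra.one_def, MonoidAlgebra.linearForm_single, hf.one,
      one_mul]
  eq_zero a := Quotient.inductionOn a fun a h => by
    refine hf.radical_iff.2 fun x => ?_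
    rw [zero_mul, map_zero]
    exact h x
  cayley a b := by
    obtain ⟨a, rfl⟩ := RingCon.mkₐ_surjective (α := K) _ a
    obtain ⟨b, rfl⟩ := RingCon.mkₐ_surjective (α := K) _ b
    induction a using MonoidAlgebra.induction_linear with
    | zero => simp
    | add a a' h h' =>
      simp only [map_add, add_mul, _root_.mul_add, add_smul, smul_add] at h h' ⊢
      linear_combination (norm := module) h + h'
    | single g c =>
      induction b using MonoidAlgebra.induction_linear with
      | zero => simp
      | add a a' h h' =>
        simp only [map_add, add_mul, _root_.mul_add, add_smul, smul_add] at h h' ⊢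
        linear_combination (norm := module) h + h'
      | single h d =>
        have := congrArg ((c * d) • ·) (hf.of_mul_add_of_mul g h)
        simp only [RingCon.mkₐ_apply, coe_single, map_smul, smul_mul_smul_comm, ← map_mul,
          reducedTrace_of, smul_eq_mul] at this ⊢
        linear_combination (norm := module) this

/-- The case in which every group element acts by a scalar. -/
theorem isSL2Character_of_scalar (hf : IsTraceFunction f) (c : G → K)
    (hc : ∀ g, c g ^ 2 - f g * c g + 1 = 0) (h : ∀ g x, f (g * x) = c g * f x) :
    IsSL2Character f := by
  have hfc : ∀ g, f g = 2 * c g := fun g => by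
    have := h g 1
    rw [mul_one, hf.one] at this
    linear_combination this
  -- As f = 2c, in characteristic two f vanishes and so does the trace of the trivial
  -- representation. Otherwise 2 cancels, c is multiplicative, and its quadratic reads c² = 1.
  by_cases h2 : (2 : K) = 0
  · exact ⟨1, fun g => by simp [hfc, h2]⟩
  · have h1 : c 1 = 1 := mul_left_cancel₀ h2 (by rw [← hfc, hf.one, mul_one])
    have hmul : ∀ x y, c (x * y) = c x * c y := fun x y =>
      mul_left_cancel₀ h2 (by linear_combination h x y - hfc (x * y) + c x * hfc y)
    refine .of_matrix_rep ((Matrix.scalar (Fin 2)).toMonoidHom.comp ⟨⟨c, h1⟩, hmul⟩)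
      (fun g => ?_) (fun g => ?_)
    · simp [hfc, two_mul]
    · have := hc g
      rw [hfc] at this
      change (Matrix.scalar (Fin 2) (c g)).det = 1
      rw [Matrix.scalar_apply, Matrix.det_diagonal, Fin.prod_univ_two]
      linear_combination -this

theorem isSL2Character (hK : IsQuadClosed K) (hf : IsTraceFunction f) : IsSL2Character f := by
  choose c hc using fun g => hK (-f g) 1
  replace hc : ∀ g, c g ^ 2 - f g * c g + 1 = 0 := fun g => by linear_combination hc g
  have hT := hf.isReducedTrace
  by_cases hs : ∀ g, hf.of g - c g • 1 = 0
  · refine hf.isSL2Character_of_scalar c hc fun g x => ?_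
    rw [← hf.reducedTrace_of, map_mul, sub_eq_zero.1 (hs g), smul_mul_assoc, one_mul, map_smul,
      hf.reducedTrace_of, smul_eq_mul]
  · push Not at hs
    obtain ⟨g, hg⟩ := hs
    have hsq : hf.of g * hf.of g = f g • hf.of g - (1 : hf.radical.Quotient) := by
      have := congrArg (hf.of g * ·) (hf.of_add_of_inv g)
      simp only [_root_.mul_add, ← map_mul, mul_inv_cancel, map_one, mul_smul_comm, mul_one] at this
      rw [← map_mul]
      exact eq_sub_of_add_eq this
    obtain ⟨φ, hφ⟩ := hT.exists_matrix_rep hg (by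
      rw [map_sub, map_smul, hT.one, hf.reducedTrace_of]
      simp only [sub_mul, mul_sub, hsq, smul_mul_assoc, mul_smul_comm, one_mul, mul_one,
        smul_eq_mul]
      have h1 : (c g ^ 2 - f g * c g + 1) • (1 : hf.radical.Quotient) = 0 := by
        rw [hc, zero_smul]
      linear_combination (norm := module) -h1)
    refine .of_matrix_rep ((φ : _ →* Matrix (Fin 2) (Fin 2) K).comp hf.of) (fun x => ?_)
      fun x => Matrix.det_eq_one_of_mul_eq_one (y := φ (hf.of x⁻¹)) ?_ ?_
    · simp [hφ, hf.reducedTrace_of]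
    · simp [← map_mul]
    · simp [hφ, hf.reducedTrace_of, ← map_add, hf.of_add_of_inv]

theorem iff_twoGenerator :
    IsTraceFunction f ↔
      ∀ H : Subgroup G, IsTwoGenerator H → IsTraceFunction (fun h : H => f (h : G)) := by
  refine ⟨fun hf H _ => ⟨fun x y => hf.mul_add x y, hf.one⟩, fun h => ⟨fun x y => ?_, ?_⟩⟩
  · have hx : x ∈ Subgroup.closure {x, y} := Subgroup.subset_closure (by simp)
    have hy : y ∈ Subgroup.closure {x, y} := Subgroup.subset_closure (by simp)
    exact (h _ ⟨x, y, rfl⟩).mul_add ⟨x, hx⟩ ⟨y, hy⟩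
  · exact (h _ ⟨1, 1, rfl⟩).one

end IsTraceFunction

theorem theorem1p1 {K : Type*} [Field K] (hK : IsQuadClosed K)
    {G : Type*} [Group G] (f : G → K) :
    (IsSL2Character f ↔
      ∀ H : Subgroup G, IsTwoGenerator H → IsSL2Character (fun h : H => f (h : G))) ∧
    (IsSL2Character f ↔ IsTraceFunction f) :=
  ⟨⟨fun hf H _ => hf.comp H.subtype, fun h => (IsTraceFunction.iff_twoGenerator.2
    fun H hH => (h H hH).isTraceFunction).isSL2Character hK⟩,
    fun hf => hf.isTraceFunction, fun hf => hf.isSL2Character hK⟩
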